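/- Fix $k\ge 1$ and let $\mathcal X=\mathbb C^{2^k}$ be the space of $k$ qubits. **General cut-and-choose protocol.** A client holds an input state $\psi\in\mathcal D(\mathcal X)$ and a unitary $U$ on $\mathcal X$, and delegates computations to a server. The protocol is given by: a probability distribution $\Omega$ on $\mathbb N=\{0,1,2,\dots\}$; for every $n$ a probability distribution $\omega_n$ on $\{1,\dots,n+1\}$; and, for every $n$ and every $\ell\in\{1,\dots,n+1\}$, a number $W$ of registers of type $\mathcal X$, a finite-dimensional ancilla space $\mathcal Y$, a test state $\chi\in\mathcal D(\mathcal X^{\otimes W}\otimes\mathcal Y)$, test unitaries $T_1,\dots,T_n$ on $\mathcal X$, an $n$-comb $\mathfrak B$ (a sequence of $n+1$ channels, consecutive ones connected by a hole of type $\mathcal X\to\mathcal X$ and by a memory register of arbitrary finite dimension) with input and output space $\mathcal X^{\otimes W}$, and a measurement operator $0\le\mu\le\mathbb 1$ on $\mathcal X^{\otimes W}\otimes\mathcal Y$ (all of these may depend on $n,\ell$). The client samples $n$ from $\Omega$ and $\ell$ from $\omega_n$ and prepares $\chi$. There are $n+1$ rounds. In round $\ell$ the client delegates $U$ on the input $\psi$;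 in the other rounds, in order, the client delegates $T_1,\dots,T_n$ on the registers in the successive holes of $\mathfrak B$. Finally the client measures $\{\mu,\mathbb 1-\mu\}$ on the output of $\mathfrak B$ together with $\mathcal Y$. On outcome $\mu$ the client outputs the register obtained in round $\ell$; otherwise it outputs $|\bot\rangle\langle\bot|$, where $|\bot\rangle$ is a unit vector orthogonal to $\mathcal X$. **Server.** An attack consists of a finite-dimensional quantum memory of the server with an initial state and, for every round $i$ and every unitary $V$ on $\mathcal X$, a channel that acts jointly on the register sent by the client and the server's memory when $V$ is delegated in round $i$. The honest server applies $V$. Let $\mathcal A$ be the set of attacks that the server is able to perform. Assume that the server can apply a unitary to the last qubit before, or can do so after, the delegated unitary: either $\mathcal A$ contains, for every $2\times2$ unitary $P$, the attack that in every round applies $V(\mathbb 1_2^{\otimes k-1}\otimes P)$ in place of $V$; or $\mathcal A$ contains, for every such $P$, the attack that in every round applies $(\mathbb 1_2^{\otimes k-1}\otimes P)V$ in place of $V$. **Correctness and security.** Let $F(\rho,\sigma)=\bigl(\operatorname{Tr}\sqrt{\sqrt\rho\,\sigma\sqrt\rho}\bigr)^2$. The protocol is $\varepsilon_H$-correct if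 for all $\psi$ and $U$ the state $\rho_H$ output with the honest server satisfies $F(\rho_H,U\psi U^\dagger)\ge 1-\varepsilon_H$. It is $\varepsilon_D$-secure if for all $\psi$ and $U$ and every attack in $\mathcal A$ the output state $\rho_D$ satisfies $$\max_{p\in[0,1]}F\bigl(\rho_D,\;p\,U\psi U^\dagger+(1-p)|\bot\rangle\langle\bot|\bigr)\ge 1-\varepsilon_D .$$ **Theorem.** Let $N=\sum_{n}\Omega(n)\,n$ be the expected number of test rounds, and assume that $N$ is finite and $N\ge\tfrac23$. If the protocol is $\varepsilon_H$-correct and $\varepsilon_D$-secure, then $$\varepsilon_H+\varepsilon_D\;\ge\;\frac1{7N^2}.$$ -/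

import Mathlib

open scoped ComplexOrder MatrixOrder Kronecker

noncomputable section

namespace VDQC

/-! ### States, channels, fidelity -/

/-- Computational basis of `k` qubits: matrices indexed by `Qubits k` are operators on the space
`𝒳 = ℂ^(2^k)`. -/
abbrev Qubits (k : ℕ) : Type := Fin k → Fin 2

/-- Density operators on the finite-dimensional space with basis `A`. -/
structure Density (A : Type) [Fintype A] where
  mat : Matrix A A ℂ
  posSemidef : mat.PosSemidef
  trace_eq_one : mat.trace = 1

/-- `Φ ⊗ id_κ`, applied to an operator on the space with basis `A × κ`. -/
def tensorId {A B : Type} (κ : Type) (Φ : Matrix A A ℂ →ₗ[ℂ] Matrix B B ℂ)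
    (ρ : Matrix (A × κ) (A × κ) ℂ) : Matrix (B × κ) (B × κ) ℂ :=
  Matrix.of fun x y => Φ (Matrix.of fun a a' => ρ (a, x.2) (a', y.2)) x.1 y.1

/-- Quantum channels: completely positive trace-preserving linear maps. -/
structure Channel (A B : Type) [Fintype A] [Fintype B] where
  map : Matrix A A ℂ →ₗ[ℂ] Matrix B B ℂ
  completelyPositive : ∀ (κ : Type) [Fintype κ] (ρ : Matrix (A × κ) (A × κ) ℂ),
    ρ.PosSemidef → (tensorId κ map ρ).PosSemidef
  tracePreserving : ∀ ρ : Matrix A A ℂ, (map ρ).trace = ρ.trace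

/-- The linear map `ρ ↦ V ρ Vᴴ`. -/
def conjMap {A : Type} [Fintype A] (V : Matrix A A ℂ) : Matrix A A ℂ →ₗ[ℂ] Matrix A A ℂ where
  toFun ρ := V * ρ * V.conjTranspose
  map_add' ρ σ := by rw [Matrix.mul_add, Matrix.add_mul]
  map_smul' c ρ := by simp

theorem tensorId_conjMap {A : Type} [Fintype A] (V : Matrix A A ℂ)
    (κ : Type) [Fintype κ] [DecidableEq κ] (ρ : Matrix (A × κ) (A × κ) ℂ) :
    tensorId κ (conjMap V) ρ
      = (V ⊗ₖ (1 : Matrix κ κ ℂ)) * ρ * (V ⊗ₖ (1 : Matrix κ κ ℂ)).conjTranspose := by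
  ext ⟨b, i⟩ ⟨b', j⟩
  simp [tensorId, conjMap, Matrix.mul_apply, Fintype.sum_prod_type, Matrix.one_apply,
    Matrix.conjTranspose_apply, apply_ite (starRingEnd ℂ)]

/-- The unitary channel `ρ ↦ V ρ Vᴴ`. -/
def unitaryChannel {A : Type} [Fintype A] [DecidableEq A] (V : Matrix.unitaryGroup A ℂ) :
    Channel A A where
  map := conjMap V.1
  completelyPositive κ _ ρ hρ := by
    classical
    rw [tensorId_conjMap]
    exact hρ.mul_mul_conjTranspose_same _
  tracePreserving ρ := by
    change (V.1 * ρ * V.1.conjTranspose).trace = ρ.trace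
    rw [Matrix.trace_mul_cycle]
    have h : V.1.conjTranspose * V.1 = 1 := Matrix.mem_unitaryGroup_iff'.1 V.2
    rw [h, Matrix.one_mul]

/-- The fidelity `F(ρ, σ) = (Tr √(√ρ σ √ρ))²`. -/
def fidelity {A : Type} [Fintype A] [DecidableEq A] (ρ σ : Matrix A A ℂ) : ℝ :=
  ((CFC.sqrt (CFC.sqrt ρ * σ * CFC.sqrt ρ)).trace.re) ^ 2

/-! ### Combs -/

/-- `Comb X Q n A`: the part of a comb from the point where its wires are `A`, with `n` holes of
type `X → X` left and with final output `Q`. It consists of `n + 1` teeth (channels). Consecutive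
teeth are connected by a hole and by a memory register of arbitrary finite dimension.
An `n`-comb with input and output `Q` is an element of `Comb X Q n Q`. -/
inductive Comb (X Q : Type) [Fintype X] [Fintype Q] : ℕ → (A : Type) → [Fintype A] → Type 1
  | last {A : Type} [Fintype A] (tooth : Channel A Q) : Comb X Q 0 A
  | step {n : ℕ} {A : Type} [Fintype A] (M : ℕ) (tooth : Channel A (X × Fin M))
      (rest : Comb X Q n (X × Fin M)) : Comb X Q (n + 1) A

/-! ### Behaviour of the server -/

/-- A behaviour of the server in the delegation rounds `0, 1, 2, …`. The server keeps a quantum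
memory (of dimension `dim i` before round `i`). If the client delegates the unitary `U` on an input
register in round `i`, then the client's register and the server's memory jointly undergo the
channel `act i U`. -/
structure Attack (X : Type) [Fintype X] [DecidableEq X] where
  dim : ℕ → ℕ
  init : Density (Fin (dim 0))
  act : (i : ℕ) → Matrix.unitaryGroup X ℂ → Channel (X × Fin (dim i)) (X × Fin (dim (i + 1)))

/-- `V ⊗ 𝟙` on a space with basis `A × B`. -/
def unitaryTensorOne {A : Type} (B : Type) [Fintype A] [DecidableEq A] [Fintype B] [DecidableEq B]
    (V : Matrix.unitaryGroup A ℂ) : Matrix.unitaryGroup (A × B) ℂ :=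
  ⟨V.1 ⊗ₖ (1 : Matrix B B ℂ), Matrix.kronecker_mem_unitary V.2 (one_mem _)⟩

/-- The server, using no memory, applies `f U` to the client's register whenever `U` is
delegated. -/
def replaceUnitary {X : Type} [Fintype X] [DecidableEq X]
    (f : Matrix.unitaryGroup X ℂ → Matrix.unitaryGroup X ℂ) : Attack X where
  dim _ := 1
  init := ⟨1, Matrix.PosSemidef.one, by simp⟩
  act _ U := unitaryChannel (unitaryTensorOne (Fin 1) (f U))

/-- The honest server applies the delegated unitary. -/
def honest (X : Type) [Fintype X] [DecidableEq X] : Attack X := replaceUnitary id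

/-- The operator on `k` qubits that acts as `V` on the last qubit and as the identity on the first
`k - 1` qubits. -/
def onLastQubit {k : ℕ} (hk : 0 < k) (V : Matrix.unitaryGroup (Fin 2) ℂ) :
    Matrix.unitaryGroup (Qubits k) ℂ :=
  ⟨Matrix.reindex
      (Equiv.funSplitAt (⟨k - 1, Nat.sub_lt hk Nat.one_pos⟩ : Fin k) (Fin 2)).symm
      (Equiv.funSplitAt (⟨k - 1, Nat.sub_lt hk Nat.one_pos⟩ : Fin k) (Fin 2)).symm
      (unitaryTensorOne _ V).1, by
    have h := Matrix.mem_unitaryGroup_iff.1 (unitaryTensorOne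
      ({j : Fin k // j ≠ ⟨k - 1, Nat.sub_lt hk Nat.one_pos⟩} → Fin 2) V).2
    rw [Matrix.mem_unitaryGroup_iff]
    rw [Matrix.star_eq_conjTranspose] at h ⊢
    rw [Matrix.conjTranspose_reindex, Matrix.reindex_apply, Matrix.reindex_apply,
      Matrix.submatrix_mul_equiv, h, Matrix.submatrix_one_equiv]⟩

/-- In every round the server applies `V` to the last qubit of the input register before the
delegated unitary. -/
def lastQubitBefore {k : ℕ} (hk : 0 < k) (V : Matrix.unitaryGroup (Fin 2) ℂ) :
    Attack (Qubits k) :=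
  replaceUnitary fun U => U * onLastQubit hk V

/-- In every round the server applies `V` to the last qubit of the output of the delegated
unitary. -/
def lastQubitAfter {k : ℕ} (hk : 0 < k) (V : Matrix.unitaryGroup (Fin 2) ℂ) :
    Attack (Qubits k) :=
  replaceUnitary fun U => onLastQubit hk V * U

/-! ### Execution of the delegation rounds

During an execution the global state lives on `A × (Y × X × S)`: the current wires `A` of the
comb, the client's ancilla `Y`, the register `X` that holds the client's input and later its
output, and the server's memory `S`. -/

/-- Regrouping for a test round: isolate the register in the hole and the server's memory. -/
def testEquiv (X M Y R S : Type) : (X × M) × (Y × R × S) ≃ (X × S) × (M × Y × R) where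
  toFun z := ((z.1.1, z.2.2.2), (z.1.2, z.2.1, z.2.2.1))
  invFun z := ((z.1.1, z.2.1), (z.2.2.1, z.2.2.2, z.1.2))
  left_inv _ := rfl
  right_inv _ := rfl

/-- Regrouping for the output round: isolate the input-output register and the server's memory. -/
def outputEquiv (A Y R S : Type) : A × (Y × R × S) ≃ (R × S) × (A × Y) where
  toFun z := ((z.2.2.1, z.2.2.2), (z.1, z.2.1))
  invFun z := (z.2.1, (z.2.2, z.1.1, z.1.2))
  left_inv _ := rfl
  right_inv _ := rfl

/-- Apply `Φ` to the subsystem isolated by `e`; `f` regroups the result. -/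
def applyOn {A B κ s t : Type} [Fintype A] [Fintype B] (Φ : Channel A B)
    (e : s ≃ A × κ) (f : t ≃ B × κ) (ρ : Matrix s s ℂ) : Matrix t t ℂ :=
  (tensorId κ Φ.map (ρ.submatrix e.symm e.symm)).submatrix f f

/-- The partial trace over the server's memory, at the end of the execution. -/
def discardMemory {Q Y R S : Type} [Fintype S]
    (ρ : Matrix (Q × (Y × R × S)) (Q × (Y × R × S)) ℂ) :
    Matrix ((Q × Y) × R) ((Q × Y) × R) ℂ :=
  Matrix.of fun a b =>
    ∑ s : S, ρ (a.1.1, (a.1.2, a.2, s)) (b.1.1, (b.1.2, b.2, s))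

section Execution

variable {X Q : Type} [Fintype X] [DecidableEq X] [Fintype Q] (Y : Type) (att : Attack X)

/-- In round `i` the unitary `T` is delegated on the register `X` in the hole of the comb. -/
def testRound (M : Type) (i : ℕ) (T : Matrix.unitaryGroup X ℂ)
    (ρ : Matrix ((X × M) × (Y × X × Fin (att.dim i))) ((X × M) × (Y × X × Fin (att.dim i))) ℂ) :
    Matrix ((X × M) × (Y × X × Fin (att.dim (i + 1))))
      ((X × M) × (Y × X × Fin (att.dim (i + 1)))) ℂ :=
  applyOn (att.act i T) (testEquiv X M Y X _) (testEquiv X M Y X _) ρ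

/-- In round `i` the unitary `U` is delegated on the client's input register. -/
def outputRound (A : Type) (i : ℕ) (U : Matrix.unitaryGroup X ℂ)
    (ρ : Matrix (A × (Y × X × Fin (att.dim i))) (A × (Y × X × Fin (att.dim i))) ℂ) :
    Matrix (A × (Y × X × Fin (att.dim (i + 1)))) (A × (Y × X × Fin (att.dim (i + 1)))) ℂ :=
  applyOn (att.act i U) (outputEquiv A Y X _) (outputEquiv A Y X _) ρ

/-- The remaining rounds, from round `i` on, when the output round is over: the teeth of the comb
alternate with the `n` remaining test rounds. -/
def runTests : {n : ℕ} → {A : Type} → [Fintype A] → Comb X Q n A →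
    (Fin n → Matrix.unitaryGroup X ℂ) → (i : ℕ) →
    Matrix (A × (Y × X × Fin (att.dim i))) (A × (Y × X × Fin (att.dim i))) ℂ →
    Matrix ((Q × Y) × X) ((Q × Y) × X) ℂ
  | _, _, _, @Comb.last _ _ _ _ _ _ tooth, _, _, ρ => discardMemory (tensorId _ tooth.map ρ)
  | _, _, _, @Comb.step _ _ _ _ _ _ _ M tooth rest, T, i, ρ =>
      runTests rest (Fin.tail T) (i + 1)
        (testRound Y att (Fin M) i (T 0) (tensorId _ tooth.map ρ))

/-- The remaining `n + 1` rounds, from round `i` on, when the output round is still to come, after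
`ℓ` further test rounds. -/
def runAll (U : Matrix.unitaryGroup X ℂ) : {n : ℕ} → {A : Type} → [Fintype A] → Comb X Q n A →
    (Fin n → Matrix.unitaryGroup X ℂ) → Fin (n + 1) → (i : ℕ) →
    Matrix (A × (Y × X × Fin (att.dim i))) (A × (Y × X × Fin (att.dim i))) ℂ →
    Matrix ((Q × Y) × X) ((Q × Y) × X) ℂ
  | _, A, _, @Comb.last _ _ _ _ _ _ tooth, T, _, i, ρ =>
      runTests Y att (.last tooth) T (i + 1) (outputRound Y att A i U ρ)
  | _, A, _, @Comb.step _ _ _ _ _ _ _ M tooth rest, T, ℓ, i, ρ =>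
      if h : ℓ = 0 then
        runTests Y att (.step M tooth rest) T (i + 1) (outputRound Y att A i U ρ)
      else
        runAll U rest (Fin.tail T) (ℓ.pred h) (i + 1)
          (testRound Y att (Fin M) i (T 0) (tensorId _ tooth.map ρ))

end Execution

/-- `Tr_P[(E ⊗ 𝟙) τ]`: the unnormalised state of the second system after the outcome with
measurement operator `E` on the first system. -/
def measureFirst {P R : Type} [Fintype P] (E : Matrix P P ℂ) (τ : Matrix (P × R) (P × R) ℂ) :
    Matrix R R ℂ :=
  Matrix.of fun x y => ∑ q : P, ∑ q' : P, E q q' * τ (q', x) (q, y)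

/-! ### The protocol -/

/-- A general cut-and-choose protocol for `k` qubits. With `n` test rounds there are `n + 1` rounds,
numbered `0, …, n`. -/
structure Protocol (k : ℕ) where
  /-- distribution of the number `n` of test rounds -/
  numTests : PMF ℕ
  /-- distribution of the output round, given `n` -/
  outputRound : (n : ℕ) → PMF (Fin (n + 1))
  /-- number of `k`-qubit registers used for the tests -/
  W : (n : ℕ) → Fin (n + 1) → ℕ
  /-- dimension of the ancilla that the client keeps -/
  dimY : (n : ℕ) → Fin (n + 1) → ℕ
  /-- test state -/
  χ : (n : ℕ) → (ℓ : Fin (n + 1)) → Density ((Fin (W n ℓ) → Qubits k) × Fin (dimY n ℓ))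
  /-- test unitaries -/
  T : (n : ℕ) → Fin (n + 1) → Fin n → Matrix.unitaryGroup (Qubits k) ℂ
  /-- the comb that composes the tests -/
  comb : (n : ℕ) → (ℓ : Fin (n + 1)) →
    Comb (Qubits k) (Fin (W n ℓ) → Qubits k) n (Fin (W n ℓ) → Qubits k)
  /-- measurement operator of the outcome "accept" -/
  μ : (n : ℕ) → (ℓ : Fin (n + 1)) →
    Matrix ((Fin (W n ℓ) → Qubits k) × Fin (dimY n ℓ))
      ((Fin (W n ℓ) → Qubits k) × Fin (dimY n ℓ)) ℂ
  μ_nonneg : ∀ n ℓ, (μ n ℓ).PosSemidef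
  μ_le_one : ∀ n ℓ, (1 - μ n ℓ).PosSemidef

namespace Protocol

variable {k : ℕ} (π : Protocol k) (att : Attack (Qubits k)) (ψ : Density (Qubits k))
  (U : Matrix.unitaryGroup (Qubits k) ℂ)

/-- The initial global state `χ ⊗ ψ ⊗ init`. -/
def initialState (n : ℕ) (ℓ : Fin (n + 1)) :
    Matrix ((Fin (π.W n ℓ) → Qubits k) × (Fin (π.dimY n ℓ) × Qubits k × Fin (att.dim 0)))
      ((Fin (π.W n ℓ) → Qubits k) × (Fin (π.dimY n ℓ) × Qubits k × Fin (att.dim 0))) ℂ :=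
  Matrix.of fun a b =>
    (π.χ n ℓ).mat (a.1, a.2.1) (b.1, b.2.1) * ψ.mat a.2.2.1 b.2.2.1 *
      att.init.mat a.2.2.2 b.2.2.2

/-- The joint state of the test registers with the client's ancilla and of the output register
after all rounds, given `n` and `ℓ`. -/
def finalState (n : ℕ) (ℓ : Fin (n + 1)) :
    Matrix (((Fin (π.W n ℓ) → Qubits k) × Fin (π.dimY n ℓ)) × Qubits k)
      (((Fin (π.W n ℓ) → Qubits k) × Fin (π.dimY n ℓ)) × Qubits k) ℂ :=
  runAll (Fin (π.dimY n ℓ)) att U (π.comb n ℓ) (π.T n ℓ) ℓ 0 (π.initialState att ψ n ℓ)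

/-- The state on `𝒳 ⊕ ℂ⊥` output by the client, given `n` and `ℓ`: the output register if the
outcome is "accept", and `⊥` otherwise. -/
def outputGiven (n : ℕ) (ℓ : Fin (n + 1)) : Matrix (Qubits k ⊕ Unit) (Qubits k ⊕ Unit) ℂ :=
  Matrix.fromBlocks (measureFirst (π.μ n ℓ) (π.finalState att ψ U n ℓ)) 0 0
    (Matrix.of fun _ _ => (measureFirst (1 - π.μ n ℓ) (π.finalState att ψ U n ℓ)).trace)

/-- The state output by the client. -/
def output : Matrix (Qubits k ⊕ Unit) (Qubits k ⊕ Unit) ℂ :=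
  ∑' n : ℕ, (π.numTests n).toReal •
    ∑ ℓ : Fin (n + 1), (π.outputRound n ℓ).toReal • π.outputGiven att ψ U n ℓ

end Protocol

/-! ### Security -/

/-- The state `p U(ψ) + (1 - p) |⊥⟩⟨⊥|` on `𝒳 ⊕ ℂ⊥`. -/
def idealOutput {k : ℕ} (ψ : Density (Qubits k)) (U : Matrix.unitaryGroup (Qubits k) ℂ) (p : ℝ) :
    Matrix (Qubits k ⊕ Unit) (Qubits k ⊕ Unit) ℂ :=
  Matrix.fromBlocks (p • (U.1 * ψ.mat * U.1.conjTranspose)) 0 0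
    (Matrix.of fun _ _ => ((1 - p : ℝ) : ℂ))

/-- `ε`-correctness. -/
def IsCorrect {k : ℕ} (π : Protocol k) (ε : ℝ) : Prop :=
  ∀ (ψ : Density (Qubits k)) (U : Matrix.unitaryGroup (Qubits k) ℂ),
    1 - ε ≤ fidelity (π.output (honest (Qubits k)) ψ U) (idealOutput ψ U 1)

/-- `ε`-security, where `𝒜` is the set of attacks that the server is able to perform on the
delegation resource. -/
def IsSecure {k : ℕ} (π : Protocol k) (𝒜 : Set (Attack (Qubits k))) (ε : ℝ) : Prop :=
  ∀ (ψ : Density (Qubits k)) (U : Matrix.unitaryGroup (Qubits k) ℂ), ∀ att ∈ 𝒜,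
    ∃ p ∈ Set.Icc (0 : ℝ) 1, 1 - ε ≤ fidelity (π.output att ψ U) (idealOutput ψ U p)

end VDQC

end

open scoped ComplexOrder MatrixOrder Kronecker

noncomputable section

namespace VDQC

/-! ### Linearity, positivity and trace of the elementary operations -/

section Elementary

variable {A B κ s t : Type}

/-! A server that turns the last qubit by a small angle `x` in every round damages the output by
order `sin x ^ 2`, while a single test notices it with probability at most `sin x`. With `N` tests
on average, `sin x` of order `1 / N` escapes detection with constant probability, and this forces an
error of order `1 / N ^ 2`.

The server keeps no memory, so the output register stays in a product state with the tests
(`runAll_replaceUnitary`). The client's output is therefore `a φ + (1 - a) |⊥⟩⟨⊥|`, where `φ` is the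
wrongly transformed input and the acceptance probability `a` depends on neither the input nor `U`
(`output_replaceUnitary`).

Detection is bounded by a hybrid argument over the holes (`acceptProb_sub_le`). It needs no diamond
norm: the honest conjugation minus the rotated one is exactly `sin x` times a difference of two
unitary channels (`conjMap_rotate`), and acceptance probabilities lie in `[0, 1]`. Averaging over
`n` gives `a₀ ≤ a + N sin x` for the honest acceptance probability `a₀`.

For the input `|0…0⟩` and `U = 1`, correctness gives `εH ≥ 1 - a₀`. The fidelity bound
`fidelity_mixBot_le` holds for every `p`, so security gives `εD ≥ a sin x ^ 2`. With `sin x = t / N`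
this leaves `(1 - t) t ^ 2 / N ^ 2`, which is largest at `t = 2 / 3` and equals `4 / (27 N ^ 2)`
there. -/

theorem tensorId_add (Φ : Matrix A A ℂ →ₗ[ℂ] Matrix B B ℂ) (ρ σ : Matrix (A × κ) (A × κ) ℂ) :
    tensorId κ Φ (ρ + σ) = tensorId κ Φ ρ + tensorId κ Φ σ := by
  ext x y
  exact congrFun (congrFun (Φ.map_add (Matrix.of fun a a' => ρ (a, x.2) (a', y.2))
    (Matrix.of fun a a' => σ (a, x.2) (a', y.2))) x.1) y.1

theorem tensorId_smul (Φ : Matrix A A ℂ →ₗ[ℂ] Matrix B B ℂ) (c : ℂ)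
    (ρ : Matrix (A × κ) (A × κ) ℂ) : tensorId κ Φ (c • ρ) = c • tensorId κ Φ ρ := by
  ext x y
  exact congrFun (congrFun (Φ.map_smul c (Matrix.of fun a a' => ρ (a, x.2) (a', y.2))) x.1) y.1

variable [Fintype A] [Fintype B]

theorem applyOn_add (Φ : Channel A B) (e : s ≃ A × κ) (f : t ≃ B × κ) (ρ σ : Matrix s s ℂ) :
    applyOn Φ e f (ρ + σ) = applyOn Φ e f ρ + applyOn Φ e f σ := by
  simp only [applyOn, Matrix.submatrix_add, Pi.add_apply, tensorId_add]

theorem applyOn_smul (Φ : Channel A B) (e : s ≃ A × κ) (f : t ≃ B × κ) (c : ℂ)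
    (ρ : Matrix s s ℂ) : applyOn Φ e f (c • ρ) = c • applyOn Φ e f ρ := by
  simp only [applyOn, Matrix.submatrix_smul, Pi.smul_apply, tensorId_smul]

variable [Fintype κ]

theorem trace_tensorId (Φ : Channel A B) (ρ : Matrix (A × κ) (A × κ) ℂ) :
    (tensorId κ Φ.map ρ).trace = ρ.trace := by
  simp only [Matrix.trace, Matrix.diag_apply, Fintype.sum_prod_type_right]
  refine Finset.sum_congr rfl fun i _ => ?_
  exact Φ.tracePreserving (Matrix.of fun a a' => ρ (a, i) (a', i))

theorem trace_submatrix_equiv {m n : Type} [Fintype m] [Fintype n] (e : m ≃ n)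
    (ρ : Matrix n n ℂ) : (ρ.submatrix e e).trace = ρ.trace :=
  Equiv.sum_comp e fun i => ρ i i

theorem posSemidef_applyOn (Φ : Channel A B) (e : s ≃ A × κ) (f : t ≃ B × κ)
    {ρ : Matrix s s ℂ} (hρ : ρ.PosSemidef) : (applyOn Φ e f ρ).PosSemidef :=
  (Φ.completelyPositive κ _ (hρ.submatrix _)).submatrix _

theorem trace_applyOn [Fintype s] [Fintype t] (Φ : Channel A B) (e : s ≃ A × κ) (f : t ≃ B × κ) (ρ : Matrix s s ℂ) :
    (applyOn Φ e f ρ).trace = ρ.trace := by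
  rw [applyOn, trace_submatrix_equiv, trace_tensorId, trace_submatrix_equiv]

end Elementary

/-! ### Combs with channels in their holes -/

section RunHoles

variable {X Q : Type} [Fintype X] [Fintype Q] (Y : Type)

/-- The comb with the channel `Φ j` in its `j`-th hole, tensored with the identity on `Y`. -/
def runHoles : {n : ℕ} → {A : Type} → [Fintype A] → Comb X Q n A → (Fin n → Channel X X) →
    Matrix (A × Y) (A × Y) ℂ → Matrix (Q × Y) (Q × Y) ℂ
  | _, _, _, @Comb.last _ _ _ _ _ _ tooth, _, σ => tensorId _ tooth.map σ
  | _, _, _, @Comb.step _ _ _ _ _ _ _ M tooth rest, Φ, σ =>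
      runHoles rest (Fin.tail Φ)
        (applyOn (Φ 0) (Equiv.prodAssoc X (Fin M) Y) (Equiv.prodAssoc X (Fin M) Y)
          (tensorId _ tooth.map σ))

theorem runHoles_add {n : ℕ} {A : Type} [Fintype A] (c : Comb X Q n A) :
    ∀ (Φ : Fin n → Channel X X) (σ τ : Matrix (A × Y) (A × Y) ℂ),
      runHoles Y c Φ (σ + τ) = runHoles Y c Φ σ + runHoles Y c Φ τ := by
  induction c with
  | last tooth => intro Φ σ τ; exact tensorId_add _ _ _
  | step M tooth rest ih => intro Φ σ τ; simp only [runHoles, tensorId_add, applyOn_add, ih]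

theorem runHoles_smul {n : ℕ} {A : Type} [Fintype A] (c : Comb X Q n A) :
    ∀ (Φ : Fin n → Channel X X) (z : ℂ) (σ : Matrix (A × Y) (A × Y) ℂ),
      runHoles Y c Φ (z • σ) = z • runHoles Y c Φ σ := by
  induction c with
  | last tooth => intro Φ z σ; exact tensorId_smul _ _ _
  | step M tooth rest ih => intro Φ z σ; simp only [runHoles, tensorId_smul, applyOn_smul, ih]

variable [Fintype Y]

theorem posSemidef_runHoles {n : ℕ} {A : Type} [Fintype A] (c : Comb X Q n A) :
    ∀ (Φ : Fin n → Channel X X) {σ : Matrix (A × Y) (A × Y) ℂ}, σ.PosSemidef →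
      (runHoles Y c Φ σ).PosSemidef := by
  induction c with
  | last tooth => intro Φ σ hσ; exact tooth.completelyPositive Y σ hσ
  | step M tooth rest ih =>
    intro Φ σ hσ
    exact ih _ (posSemidef_applyOn _ _ _ (tooth.completelyPositive Y σ hσ))

theorem trace_runHoles {n : ℕ} {A : Type} [Fintype A] (c : Comb X Q n A) :
    ∀ (Φ : Fin n → Channel X X) (σ : Matrix (A × Y) (A × Y) ℂ),
      (runHoles Y c Φ σ).trace = σ.trace := by
  induction c with
  | last tooth => intro Φ σ; exact trace_tensorId _ _
  | step M tooth rest ih =>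
    intro Φ σ
    simp only [runHoles, ih, trace_applyOn, trace_tensorId]

/-- Probability of the outcome with measurement operator `E` on the output of the comb. -/
def acceptProb (E : Matrix (Q × Y) (Q × Y) ℂ) {n : ℕ} {A : Type} [Fintype A] (c : Comb X Q n A)
    (Φ : Fin n → Channel X X) (σ : Matrix (A × Y) (A × Y) ℂ) : ℝ :=
  (E * runHoles Y c Φ σ).trace.re

end RunHoles

theorem trace_mul_nonneg {m : Type} [Fintype m] {E ρ : Matrix m m ℂ}
    (hE : E.PosSemidef) (hρ : ρ.PosSemidef) : 0 ≤ (E * ρ).trace := by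
  classical
  -- Writing `E = Bᴴ B` turns the trace, by cyclicity, into that of the positive operator `B ρ Bᴴ`.
  obtain ⟨B, rfl⟩ := CStarAlgebra.nonneg_iff_eq_star_mul_self.1 hE.nonneg
  rw [Matrix.star_eq_conjTranspose]
  rw [Matrix.mul_assoc, Matrix.trace_mul_comm]
  exact (hρ.mul_mul_conjTranspose_same B).trace_nonneg

/-! ### The hybrid argument -/

section Hybrid

variable {X Q : Type} [Fintype X] [Fintype Q] (Y : Type) [Fintype Y]

theorem acceptProb_nonneg {E : Matrix (Q × Y) (Q × Y) ℂ} (hE : E.PosSemidef) {n : ℕ} {A : Type}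
    [Fintype A] (c : Comb X Q n A) (Φ : Fin n → Channel X X) {σ : Matrix (A × Y) (A × Y) ℂ}
    (hσ : σ.PosSemidef) : 0 ≤ acceptProb Y E c Φ σ :=
  (Complex.le_def.1 (trace_mul_nonneg hE (posSemidef_runHoles Y c Φ hσ))).1

theorem acceptProb_le [DecidableEq Q] [DecidableEq Y] {E : Matrix (Q × Y) (Q × Y) ℂ} (hE : (1 - E).PosSemidef) {n : ℕ} {A : Type}
    [Fintype A] (c : Comb X Q n A) (Φ : Fin n → Channel X X) {σ : Matrix (A × Y) (A × Y) ℂ}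
    (hσ : σ.PosSemidef) : acceptProb Y E c Φ σ ≤ σ.trace.re := by
  have h := (Complex.le_def.1 (trace_mul_nonneg hE (posSemidef_runHoles Y c Φ hσ))).1
  rw [Matrix.sub_mul, Matrix.one_mul, Matrix.trace_sub, trace_runHoles, Complex.sub_re,
    Complex.zero_re] at h
  exact sub_nonneg.1 h

/-- Linearity of the comb transfers an identity between input operators to probabilities. Written
with sums on both sides, it compares `σ - σ₁` with `s • (σ₂ - σ₃)`. -/
theorem acceptProb_sub_eq (E : Matrix (Q × Y) (Q × Y) ℂ) {n : ℕ} {A : Type}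
    [Fintype A] (c : Comb X Q n A) (Φ : Fin n → Channel X X)
    {σ σ₁ σ₂ σ₃ : Matrix (A × Y) (A × Y) ℂ} (s : ℝ) (h : σ + (s : ℂ) • σ₃ = σ₁ + (s : ℂ) • σ₂) :
    acceptProb Y E c Φ σ + s * acceptProb Y E c Φ σ₃
      = acceptProb Y E c Φ σ₁ + s * acceptProb Y E c Φ σ₂ := by
  have h' := congrArg (fun τ => (E * runHoles Y c Φ τ).trace.re) h
  simpa only [acceptProb, runHoles_add, runHoles_smul, Matrix.mul_add, Matrix.mul_smul, Matrix.trace_add,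
    Matrix.trace_smul, Complex.add_re, smul_eq_mul, Complex.re_ofReal_mul] using h'

/-- If `Φ j - Ψ j = s • (Θ j - Θ' j)` for channels `Θ j` and `Θ' j`, then replacing `Φ` by `Ψ` in
all `n` holes lowers the acceptance probability by at most `n * s`. -/
theorem acceptProb_sub_le [DecidableEq Q] [DecidableEq Y] {E : Matrix (Q × Y) (Q × Y) ℂ} (hE : E.PosSemidef)
    (hE' : (1 - E).PosSemidef) {s : ℝ} (hs : 0 ≤ s) {n : ℕ} {A : Type} [Fintype A]
    (c : Comb X Q n A) :
    ∀ (Φ Ψ Θ Θ' : Fin n → Channel X X)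
      (_ : ∀ j, (Φ j).map + (s : ℂ) • (Θ' j).map = (Ψ j).map + (s : ℂ) • (Θ j).map)
      {σ : Matrix (A × Y) (A × Y) ℂ}, σ.PosSemidef →
      acceptProb Y E c Φ σ ≤ acceptProb Y E c Ψ σ + n * s * σ.trace.re := by
  induction c with
  | last tooth => intro Φ Ψ Θ Θ' h σ hσ; simp [acceptProb, runHoles]
  | @step n A _ M tooth rest ih =>
    intro Φ Ψ Θ Θ' h σ hσ
    set e := Equiv.prodAssoc X (Fin M) Y
    set ρ := tensorId Y tooth.map σ with hρdef
    have hρ : ρ.PosSemidef := tooth.completelyPositive Y σ hσ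
    have htr : ρ.trace = σ.trace := trace_tensorId _ _
    have hsum : applyOn (Φ 0) e e ρ + (s : ℂ) • applyOn (Θ' 0) e e ρ
        = applyOn (Ψ 0) e e ρ + (s : ℂ) • applyOn (Θ 0) e e ρ := by
      ext a b
      exact congrFun (congrFun (LinearMap.congr_fun (h 0)
        (Matrix.of fun i j => ρ.submatrix e.symm e.symm (i, (e a).2) (j, (e b).2))) (e a).1) (e b).1
    -- Only the first hole is exchanged here, with `Φ` kept in the later ones. The cost is `s` times
    -- a difference of two numbers in `[0, tr σ]`, hence at most `s * tr σ` and not twice that. The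
    -- induction hypothesis then exchanges the later holes, with `Ψ 0` already in place.
    have h1 := acceptProb_sub_eq Y E rest (Fin.tail Φ) s hsum
    have h2 := acceptProb_nonneg Y hE rest (Fin.tail Φ) (posSemidef_applyOn (Θ' 0) e e hρ)
    have h3 := acceptProb_le Y hE' rest (Fin.tail Φ) (posSemidef_applyOn (Θ 0) e e hρ)
    have h4 := ih (Fin.tail Φ) (Fin.tail Ψ) (Fin.tail Θ) (Fin.tail Θ') (fun j => h j.succ)
      (posSemidef_applyOn (Ψ 0) e e hρ)
    rw [trace_applyOn, htr] at h3 h4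
    have h5 := mul_nonneg hs h2
    have h6 := mul_le_mul_of_nonneg_left h3 hs
    change acceptProb Y E rest (Fin.tail Φ) (applyOn (Φ 0) e e ρ)
      ≤ acceptProb Y E rest (Fin.tail Ψ) (applyOn (Ψ 0) e e ρ) + _
    push_cast
    linarith

end Hybrid

/-! ### A memoryless server: the output register is independent of the tests -/

section Factorization

/-- The product of the state `σ` of the comb's wires and the client's ancilla with the state `φ` of
the client's register, when the server has a trivial memory. -/
def prodState {A Y R : Type} (S : Type) (σ : Matrix (A × Y) (A × Y) ℂ) (φ : Matrix R R ℂ) :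
    Matrix (A × (Y × R × S)) (A × (Y × R × S)) ℂ :=
  Matrix.of fun a b => σ (a.1, a.2.1) (b.1, b.2.1) * φ a.2.2.1 b.2.2.1

theorem tensorId_prodState {A B Y R : Type} (S : Type) (Φ : Matrix A A ℂ →ₗ[ℂ] Matrix B B ℂ)
    (σ : Matrix (A × Y) (A × Y) ℂ) (φ : Matrix R R ℂ) :
    tensorId _ Φ (prodState S σ φ) = prodState S (tensorId _ Φ σ) φ := by
  ext ⟨b, y, x, i⟩ ⟨b', y', x', i'⟩
  have h := congrFun (congrFun (Φ.map_smul (φ x x')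
    (Matrix.of fun a a' => σ (a, y) (a', y'))) b) b'
  simp only [Matrix.smul_apply, smul_eq_mul] at h
  simp only [tensorId, prodState, Matrix.of_apply]
  rw [mul_comm, ← h]
  refine congrFun (congrFun (congrArg Φ ?_) b) b'
  ext a a'
  exact mul_comm _ _

theorem conjMap_unitaryTensorOne {X : Type} [Fintype X] [DecidableEq X]
    (V : Matrix.unitaryGroup X ℂ) (N : Matrix X X ℂ) (x x' : X) (i i' : Fin 1) :
    conjMap (unitaryTensorOne (Fin 1) V).1 (Matrix.of fun z z' => N z.1 z'.1) (x, i) (x', i')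
      = conjMap V.1 N x x' := by
  simp [conjMap, unitaryTensorOne, Matrix.mul_apply, Fintype.sum_prod_type,
    Subsingleton.elim i 0, Subsingleton.elim i' 0]

variable {X Q : Type} [Fintype X] [DecidableEq X] [Fintype Q] (Y : Type)
  (f : Matrix.unitaryGroup X ℂ → Matrix.unitaryGroup X ℂ)

theorem testRound_replaceUnitary (M : Type) (i : ℕ) (T : Matrix.unitaryGroup X ℂ)
    (σ : Matrix ((X × M) × Y) ((X × M) × Y) ℂ) (φ : Matrix X X ℂ) :
    testRound Y (replaceUnitary f) M i T (prodState (Fin 1) σ φ)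
      = prodState (Fin 1) (applyOn (unitaryChannel (f T)) (Equiv.prodAssoc X M Y)
          (Equiv.prodAssoc X M Y) σ) φ := by
  ext ⟨⟨x, m⟩, y, r, j⟩ ⟨⟨x', m'⟩, y', r', j'⟩
  have h := conjMap_unitaryTensorOne (f T)
    (φ r r' • Matrix.of fun a a' => σ ((a, m), y) ((a', m'), y')) x x' j j'
  rw [map_smul, Matrix.smul_apply, smul_eq_mul, mul_comm] at h
  refine Eq.trans ?_ h
  refine congrFun (congrFun (congrArg (conjMap (unitaryTensorOne (Fin 1) (f T)).1) ?_) (x, j))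
    (x', j')
  ext z z'
  exact mul_comm _ _

theorem outputRound_replaceUnitary (A : Type) (i : ℕ) (U : Matrix.unitaryGroup X ℂ)
    (σ : Matrix (A × Y) (A × Y) ℂ) (φ : Matrix X X ℂ) :
    outputRound Y (replaceUnitary f) A i U (prodState (Fin 1) σ φ)
      = prodState (Fin 1) σ (conjMap (f U).1 φ) := by
  ext ⟨a, y, r, j⟩ ⟨a', y', r', j'⟩
  have h := conjMap_unitaryTensorOne (f U) (σ (a, y) (a', y') • φ) r r' j j'
  rw [map_smul, Matrix.smul_apply, smul_eq_mul] at h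
  exact h

theorem runTests_replaceUnitary {n : ℕ} {A : Type} [Fintype A] (c : Comb X Q n A) :
    ∀ (T : Fin n → Matrix.unitaryGroup X ℂ) (i : ℕ) (σ : Matrix (A × Y) (A × Y) ℂ)
      (φ : Matrix X X ℂ),
      runTests Y (replaceUnitary f) c T i (prodState (Fin 1) σ φ)
        = Matrix.of fun a b =>
            runHoles Y c (fun j => unitaryChannel (f (T j))) σ a.1 b.1 * φ a.2 b.2 := by
  induction c with
  | last tooth =>
    intro T i σ φ
    change discardMemory (S := Fin 1) (tensorId _ tooth.map (prodState (Fin 1) σ φ)) = _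
    rw [tensorId_prodState]
    ext a b
    simp [discardMemory, prodState, runHoles]
  | step M tooth rest ih =>
    intro T i σ φ
    have h := (congrArg (testRound Y (replaceUnitary f) (Fin M) i (T 0))
      (tensorId_prodState (Fin 1) tooth.map σ φ)).trans
        (testRound_replaceUnitary Y f (Fin M) i (T 0) _ φ)
    exact (congrArg (runTests Y (replaceUnitary f) rest (Fin.tail T) (i + 1)) h).trans
      (ih (Fin.tail T) (i + 1) _ φ)

/-- Test rounds and the output round act on different factors of a product state, so the position
`ℓ` of the output round is irrelevant to the resulting state. -/
theorem runAll_replaceUnitary (U : Matrix.unitaryGroup X ℂ) {n : ℕ} {A : Type} [Fintype A]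
    (c : Comb X Q n A) :
    ∀ (T : Fin n → Matrix.unitaryGroup X ℂ) (ℓ : Fin (n + 1)) (i : ℕ)
      (σ : Matrix (A × Y) (A × Y) ℂ) (φ : Matrix X X ℂ),
      runAll Y (replaceUnitary f) U c T ℓ i (prodState (Fin 1) σ φ)
        = Matrix.of fun a b => runHoles Y c (fun j => unitaryChannel (f (T j))) σ a.1 b.1
            * conjMap (f U).1 φ a.2 b.2 := by
  induction c with
  | last tooth =>
    intro T ℓ i σ φ
    change runTests Y (replaceUnitary f) (.last tooth) T (i + 1)
      (outputRound Y (replaceUnitary f) _ i U (prodState (Fin 1) σ φ)) = _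
    rw [outputRound_replaceUnitary, runTests_replaceUnitary]
  | step M tooth rest ih =>
    intro T ℓ i σ φ
    by_cases h : ℓ = 0
    · exact (dif_pos h).trans ((congrArg _ (outputRound_replaceUnitary Y f _ i U σ φ)).trans
        (runTests_replaceUnitary Y f (.step M tooth rest) T (i + 1) σ _))
    · have h' := (congrArg (testRound Y (replaceUnitary f) (Fin M) i (T 0))
        (tensorId_prodState (Fin 1) tooth.map σ φ)).trans
          (testRound_replaceUnitary Y f (Fin M) i (T 0) _ φ)
      exact (dif_neg h).trans ((congrArg (runAll Y (replaceUnitary f) U rest (Fin.tail T)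
        (ℓ.pred h) (i + 1)) h').trans (ih (Fin.tail T) (ℓ.pred h) (i + 1) _ φ))

end Factorization

/-! ### The output of the protocol with a memoryless server -/

/-- On a product state, conditioning on a test outcome only rescales the other register. -/
theorem measureFirst_prod {P R : Type} [Fintype P] (E τ : Matrix P P ℂ) (φ : Matrix R R ℂ) :
    measureFirst E (Matrix.of fun a b : P × R => τ a.1 b.1 * φ a.2 b.2)
      = (E * τ).trace • φ := by
  ext x y
  simp [measureFirst, Matrix.trace, Matrix.mul_apply, Finset.sum_mul, mul_assoc]

/-- Acceptance probabilities are defined as real parts; positivity shows that nothing is lost. -/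
theorem ofReal_re_trace_mul {m : Type} [Fintype m] {E ρ : Matrix m m ℂ}
    (hE : E.PosSemidef) (hρ : ρ.PosSemidef) : (((E * ρ).trace.re : ℝ) : ℂ) = (E * ρ).trace :=
  Complex.ext rfl (Complex.le_def.1 (trace_mul_nonneg hE hρ)).2

/-- The operator `x φ + y |⊥⟩⟨⊥|`. -/
def withBot {X : Type} (φ : Matrix X X ℂ) (x y : ℝ) : Matrix (X ⊕ Unit) (X ⊕ Unit) ℂ :=
  Matrix.fromBlocks ((x : ℂ) • φ) 0 0 (Matrix.of fun _ _ => (y : ℂ))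

/-- The state `a φ + (1 - a) |⊥⟩⟨⊥|`. -/
def mixBot {X : Type} (a : ℝ) (φ : Matrix X X ℂ) : Matrix (X ⊕ Unit) (X ⊕ Unit) ℂ :=
  withBot φ a (1 - a)

namespace Protocol

variable {k : ℕ} (π : Protocol k)
  (f : Matrix.unitaryGroup (Qubits k) ℂ → Matrix.unitaryGroup (Qubits k) ℂ)

/-- The probability that the client accepts, given `n` and `ℓ`, if `f V` is applied in place
of `V`. -/
def acceptGiven (n : ℕ) (ℓ : Fin (n + 1)) : ℝ :=
  acceptProb (Fin (π.dimY n ℓ)) (π.μ n ℓ) (π.comb n ℓ)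
    (fun j => unitaryChannel (f (π.T n ℓ j))) (π.χ n ℓ).mat

theorem acceptGiven_nonneg (n : ℕ) (ℓ : Fin (n + 1)) : 0 ≤ π.acceptGiven f n ℓ :=
  acceptProb_nonneg _ (π.μ_nonneg n ℓ) _ _ (π.χ n ℓ).posSemidef

theorem acceptGiven_le_one (n : ℕ) (ℓ : Fin (n + 1)) : π.acceptGiven f n ℓ ≤ 1 := by
  have h := acceptProb_le _ (π.μ_le_one n ℓ) (π.comb n ℓ)
    (fun j => unitaryChannel (f (π.T n ℓ j))) (π.χ n ℓ).posSemidef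
  rwa [(π.χ n ℓ).trace_eq_one, Complex.one_re] at h

theorem outputGiven_replaceUnitary (ψ : Density (Qubits k)) (U : Matrix.unitaryGroup (Qubits k) ℂ)
    (n : ℕ) (ℓ : Fin (n + 1)) :
    π.outputGiven (replaceUnitary f) ψ U n ℓ
      = mixBot (π.acceptGiven f n ℓ) (conjMap (f U).1 ψ.mat) := by
  have hinit : π.initialState (replaceUnitary f) ψ n ℓ
      = prodState (Fin 1) (π.χ n ℓ).mat ψ.mat := by
    ext ⟨a, y, x, i⟩ ⟨a', y', x', i'⟩
    have h : ∀ i i' : Fin 1, (1 : Matrix (Fin 1) (Fin 1) ℂ) i i' = 1 := fun i i' => by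
      rw [Subsingleton.elim i i', Matrix.one_apply_eq]
    exact (congrArg _ (h i i')).trans (mul_one _)
  have hfin : π.finalState (replaceUnitary f) ψ U n ℓ = _ :=
    (congrArg _ hinit).trans (runAll_replaceUnitary _ f U (π.comb n ℓ) (π.T n ℓ) ℓ 0 _ _)
  have htr : (conjMap (f U).1 ψ.mat).trace = 1 :=
    ((unitaryChannel (f U)).tracePreserving ψ.mat).trans ψ.trace_eq_one
  have hq := ofReal_re_trace_mul (π.μ_nonneg n ℓ) (posSemidef_runHoles (Fin (π.dimY n ℓ))
    (π.comb n ℓ) (fun j => unitaryChannel (f (π.T n ℓ j))) (π.χ n ℓ).posSemidef)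
  have htr' := trace_runHoles (Fin (π.dimY n ℓ)) (π.comb n ℓ)
    (fun j => unitaryChannel (f (π.T n ℓ j))) (π.χ n ℓ).mat
  rw [(π.χ n ℓ).trace_eq_one] at htr'
  rw [outputGiven, hfin, measureFirst_prod, measureFirst_prod, Matrix.trace_smul, htr,
    Matrix.sub_mul, Matrix.one_mul, Matrix.trace_sub, htr', ← hq]
  simp [mixBot, withBot, acceptGiven, acceptProb]

/-- The probability that the client accepts, given `n`. -/
def acceptRounds (n : ℕ) : ℝ :=
  ∑ ℓ : Fin (n + 1), (π.outputRound n ℓ).toReal * π.acceptGiven f n ℓ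

theorem sum_outputRound (n : ℕ) : ∑ ℓ : Fin (n + 1), (π.outputRound n ℓ).toReal = 1 := by
  rw [← ENNReal.toReal_sum fun ℓ _ => (π.outputRound n).apply_ne_top ℓ, ← tsum_fintype (L := .unconditional _),
    PMF.tsum_coe, ENNReal.toReal_one]

theorem acceptRounds_nonneg (n : ℕ) : 0 ≤ π.acceptRounds f n :=
  Finset.sum_nonneg fun ℓ _ => mul_nonneg ENNReal.toReal_nonneg (π.acceptGiven_nonneg f n ℓ)

theorem acceptRounds_le_one (n : ℕ) : π.acceptRounds f n ≤ 1 := by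
  rw [← π.sum_outputRound n]
  exact Finset.sum_le_sum fun ℓ _ =>
    mul_le_of_le_one_right ENNReal.toReal_nonneg (π.acceptGiven_le_one f n ℓ)

theorem hasSum_numTests : HasSum (fun n => (π.numTests n).toReal) 1 := by
  have h := (ENNReal.summable_toReal π.numTests.tsum_coe_ne_top).hasSum
  rwa [← ENNReal.tsum_toReal_eq π.numTests.apply_ne_top, PMF.tsum_coe, ENNReal.toReal_one] at h

/-- The probability that the client accepts. -/
def accept : ℝ := ∑' n, (π.numTests n).toReal * π.acceptRounds f n

theorem hasSum_accept :
    HasSum (fun n => (π.numTests n).toReal * π.acceptRounds f n) (π.accept f) :=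
  (Summable.of_nonneg_of_le
    (fun n => mul_nonneg ENNReal.toReal_nonneg (π.acceptRounds_nonneg f n))
    (fun n => mul_le_of_le_one_right ENNReal.toReal_nonneg (π.acceptRounds_le_one f n))
    π.hasSum_numTests.summable).hasSum

theorem accept_nonneg : 0 ≤ π.accept f :=
  tsum_nonneg fun n => mul_nonneg ENNReal.toReal_nonneg (π.acceptRounds_nonneg f n)

theorem accept_le_one : π.accept f ≤ 1 :=
  hasSum_le (fun n => mul_le_of_le_one_right ENNReal.toReal_nonneg (π.acceptRounds_le_one f n))
    (π.hasSum_accept f) π.hasSum_numTests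

/-- Affinity in `a` lets averages over `ℓ` and `n` pass to the acceptance probability. -/
theorem mixBot_eq {X : Type} (a : ℝ) (φ : Matrix X X ℂ) :
    mixBot a φ = mixBot 0 φ + a • (mixBot 1 φ - mixBot 0 φ) := by
  ext (i | i) (j | j) <;> simp [mixBot, withBot, sub_eq_add_neg]

theorem output_replaceUnitary (ψ : Density (Qubits k)) (U : Matrix.unitaryGroup (Qubits k) ℂ) :
    π.output (replaceUnitary f) ψ U = mixBot (π.accept f) (conjMap (f U).1 ψ.mat) := by
  -- The output is a `tsum` of matrices, so convergence has to be shown as well; it follows from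
  -- that of the two scalar series.
  refine HasSum.tsum_eq ?_
  rw [mixBot_eq]
  have h := (π.hasSum_numTests.smul_const (mixBot 0 (conjMap (f U).1 ψ.mat))).add
    ((π.hasSum_accept f).smul_const
      (mixBot 1 (conjMap (f U).1 ψ.mat) - mixBot 0 (conjMap (f U).1 ψ.mat)))
  rw [one_smul] at h
  refine h.congr_fun fun n => ?_
  simp only [outputGiven_replaceUnitary]
  rw [mul_smul, ← smul_add]
  congr 1
  have h1 : ∀ ℓ, (π.outputRound n ℓ).toReal • mixBot (π.acceptGiven f n ℓ)
      (conjMap (f U).1 ψ.mat) = (π.outputRound n ℓ).toReal • mixBot 0 (conjMap (f U).1 ψ.mat)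
        + ((π.outputRound n ℓ).toReal * π.acceptGiven f n ℓ) •
          (mixBot 1 (conjMap (f U).1 ψ.mat) - mixBot 0 (conjMap (f U).1 ψ.mat)) := fun ℓ => by
    rw [mixBot_eq (π.acceptGiven f n ℓ), smul_add, mul_smul]
  simp only [h1, Finset.sum_add_distrib, ← Finset.sum_smul, sum_outputRound, one_smul,
    acceptRounds]

/-- If the conjugations by `f V` and `g V` differ by `s` times a difference of two unitary
conjugations for all `V`, then the acceptance probabilities differ by at most `N s`. -/
theorem accept_le_add (g h h' : Matrix.unitaryGroup (Qubits k) ℂ → Matrix.unitaryGroup (Qubits k) ℂ)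
    {s N : ℝ} (hs : 0 ≤ s)
    (hfg : ∀ V, conjMap (f V).1 + (s : ℂ) • conjMap (h' V).1
      = conjMap (g V).1 + (s : ℂ) • conjMap (h V).1)
    (hN : HasSum (fun n : ℕ => (π.numTests n).toReal * (n : ℝ)) N) :
    π.accept f ≤ π.accept g + N * s := by
  have h1 : ∀ n ℓ, π.acceptGiven f n ℓ ≤ π.acceptGiven g n ℓ + n * s := fun n ℓ => by
    have h2 := acceptProb_sub_le _ (π.μ_nonneg n ℓ) (π.μ_le_one n ℓ) hs (π.comb n ℓ)
      (fun j => unitaryChannel (f (π.T n ℓ j))) (fun j => unitaryChannel (g (π.T n ℓ j)))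
      (fun j => unitaryChannel (h (π.T n ℓ j))) (fun j => unitaryChannel (h' (π.T n ℓ j)))
      (fun j => hfg _) (π.χ n ℓ).posSemidef
    rwa [(π.χ n ℓ).trace_eq_one, Complex.one_re, mul_one] at h2
  have h3 : ∀ n, π.acceptRounds f n ≤ π.acceptRounds g n + n * s := fun n => by
    calc π.acceptRounds f n
        ≤ ∑ ℓ : Fin (n + 1), (π.outputRound n ℓ).toReal * (π.acceptGiven g n ℓ + n * s) :=
          Finset.sum_le_sum fun ℓ _ => mul_le_mul_of_nonneg_left (h1 n ℓ) ENNReal.toReal_nonneg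
      _ = π.acceptRounds g n + n * s := by
          simp only [mul_add, Finset.sum_add_distrib, ← Finset.sum_mul, sum_outputRound, one_mul,
            acceptRounds]
  refine hasSum_le (fun n => ?_) (π.hasSum_accept f) ((π.hasSum_accept g).add (hN.mul_right s))
  have := mul_le_mul_of_nonneg_left (h3 n) (ENNReal.toReal_nonneg (a := π.numTests n))
  linarith

end Protocol

/-! ### Fidelities -/

section Fidelity

variable {X : Type}

theorem withBot_mul [Fintype X] (φ ψ : Matrix X X ℂ) (x y x' y' : ℝ) :
    withBot φ x y * withBot ψ x' y' = withBot (φ * ψ) (x * x') (y * y') := by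
  rw [withBot, withBot, withBot, Matrix.fromBlocks_multiply]
  congr 1
  · rw [Matrix.smul_mul, Matrix.mul_smul, smul_smul, Matrix.mul_zero, add_zero,
      Complex.ofReal_mul]
  · simp
  · simp
  · ext i j
    simp [Matrix.mul_apply]

theorem isHermitian_withBot {φ : Matrix X X ℂ} (hφ : φ.IsHermitian) (x y : ℝ) :
    (withBot φ x y).IsHermitian := by
  refine Matrix.IsHermitian.fromBlocks ?_ (by simp) ?_
  · rw [Matrix.IsHermitian, Matrix.conjTranspose_smul, hφ.eq]
    simp
  · ext i j
    simp

theorem withBot_smul (φ : Matrix X X ℂ) (c x y : ℝ) :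
    withBot ((c : ℂ) • φ) x y = withBot φ (x * c) y := by
  rw [withBot, withBot, smul_smul, Complex.ofReal_mul]

variable [Fintype X]

theorem posSemidef_withBot {φ : Matrix X X ℂ} (hφ : φ.IsHermitian) (hφ' : φ * φ = φ) {x y : ℝ}
    (hx : 0 ≤ x) (hy : 0 ≤ y) : (withBot φ x y).PosSemidef := by
  have h := Matrix.posSemidef_self_mul_conjTranspose (withBot φ √x √y)
  rwa [(isHermitian_withBot hφ _ _).eq, withBot_mul, hφ', Real.mul_self_sqrt hx,
    Real.mul_self_sqrt hy] at h

theorem sqrt_withBot [DecidableEq X] {φ : Matrix X X ℂ} (hφ : φ.IsHermitian) (hφ' : φ * φ = φ) {x y : ℝ}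
    (hx : 0 ≤ x) (hy : 0 ≤ y) : CFC.sqrt (withBot φ x y) = withBot φ √x √y := by
  refine CFC.sqrt_unique ?_
    (posSemidef_withBot hφ hφ' (Real.sqrt_nonneg x) (Real.sqrt_nonneg y)).nonneg
  rw [withBot_mul, hφ', Real.mul_self_sqrt hx, Real.mul_self_sqrt hy]

theorem trace_withBot (φ : Matrix X X ℂ) (x y : ℝ) :
    (withBot φ x y).trace = x * φ.trace + y := by
  simp [withBot, Matrix.trace, Finset.mul_sum]

/-- Here `φ` is a projection of trace one and `φ ψ φ` is a multiple of it, so all operators under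
the square roots are combinations of `φ` and `|⊥⟩⟨⊥|`, and the roots are taken coefficientwise. -/
theorem fidelity_mixBot [DecidableEq X] {φ ψ : Matrix X X ℂ} (hφ : φ.IsHermitian) (hφ' : φ * φ = φ)
    (htr : φ.trace = 1) {c : ℝ} (hc : 0 ≤ c) (hφψ : φ * ψ * φ = ((c ^ 2 : ℝ) : ℂ) • φ) {a p : ℝ}
    (ha : 0 ≤ a) (ha' : a ≤ 1) (hp : 0 ≤ p) (hp' : p ≤ 1) :
    fidelity (mixBot a φ) (mixBot p ψ) = (√a * √p * c + √(1 - a) * √(1 - p)) ^ 2 := by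
  have ha1 := sub_nonneg.2 ha'
  have hp1 := sub_nonneg.2 hp'
  have h1 : √a * p * √a * c ^ 2 = (√a * √p * c) ^ 2 := by
    rw [mul_pow, mul_pow, Real.sq_sqrt hp]; ring
  have h2 : √(1 - a) * (1 - p) * √(1 - a) = (√(1 - a) * √(1 - p)) ^ 2 := by
    rw [mul_pow, Real.sq_sqrt hp1]; ring
  rw [fidelity, mixBot, mixBot, sqrt_withBot hφ hφ' ha ha1, withBot_mul, withBot_mul, hφψ,
    withBot_smul, h1, h2, sqrt_withBot hφ hφ' (sq_nonneg _) (sq_nonneg _), trace_withBot, htr,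
    Real.sqrt_sq (by positivity), Real.sqrt_sq (by positivity)]
  norm_cast
  rw [mul_one]

theorem fidelity_mixBot_le [DecidableEq X] {φ ψ : Matrix X X ℂ} (hφ : φ.IsHermitian) (hφ' : φ * φ = φ)
    (htr : φ.trace = 1) {c : ℝ} (hc : 0 ≤ c) (hφψ : φ * ψ * φ = ((c ^ 2 : ℝ) : ℂ) • φ) {a p : ℝ}
    (ha : 0 ≤ a) (ha' : a ≤ 1) (hp : 0 ≤ p) (hp' : p ≤ 1) :
    fidelity (mixBot a φ) (mixBot p ψ) ≤ 1 - a * (1 - c ^ 2) := by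
  rw [fidelity_mixBot hφ hφ' htr hc hφψ ha ha' hp hp']
  have h1 := Real.sq_sqrt ha
  have h2 := Real.sq_sqrt hp
  have h3 := Real.sq_sqrt (sub_nonneg.2 ha')
  have h4 := Real.sq_sqrt (sub_nonneg.2 hp')
  -- Cauchy–Schwarz for `(√a c, √(1 - a))` and `(√p, √(1 - p))`. The second vector has norm one,
  -- which removes `p`.
  calc (√a * √p * c + √(1 - a) * √(1 - p)) ^ 2
      ≤ ((√a * c) ^ 2 + √(1 - a) ^ 2) * (√p ^ 2 + √(1 - p) ^ 2) := by
        linarith [sq_nonneg (√a * c * √(1 - p) - √(1 - a) * √p)]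
    _ = 1 - a * (1 - c ^ 2) := by
        rw [mul_pow, h1, h2, h3, h4]; ring

end Fidelity

theorem idealOutput_eq_mixBot {k : ℕ} (ψ : Density (Qubits k))
    (U : Matrix.unitaryGroup (Qubits k) ℂ) (p : ℝ) :
    idealOutput ψ U p = mixBot p (conjMap U.1 ψ.mat) := by
  ext (i | i) (j | j) <;> simp [idealOutput, mixBot, withBot, conjMap]

/-! ### Rotations of the last qubit -/

/-- The rotation of a qubit by the angle `x`. -/
def rotation (x : ℝ) : Matrix.unitaryGroup (Fin 2) ℂ :=
  ⟨!![(Real.cos x : ℂ), -(Real.sin x : ℂ); (Real.sin x : ℂ), (Real.cos x : ℂ)], by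
    have h : (Real.cos x : ℂ) ^ 2 + (Real.sin x : ℂ) ^ 2 = 1 := by
      exact_mod_cast Real.cos_sq_add_sin_sq x
    rw [Matrix.mem_unitaryGroup_iff, Matrix.star_eq_conjTranspose]
    ext i j
    fin_cases i <;> fin_cases j <;>
      simp only [Matrix.mul_apply, Fin.sum_univ_two, Matrix.conjTranspose_apply] <;>
      simp [Complex.conj_ofReal, -Complex.ofReal_cos, -Complex.ofReal_sin] <;>
      first | linear_combination h | ring⟩

theorem exists_onLastQubit_rotation {k : ℕ} (hk : 0 < k) :
    ∃ J : Matrix (Qubits k) (Qubits k) ℂ, J 0 0 = 0 ∧ ∀ x : ℝ,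
      (onLastQubit hk (rotation x)).1 = (Real.cos x : ℂ) • 1 + (Real.sin x : ℂ) • J := by
  -- `J` is the rotation by a right angle, which sends `|0…0⟩` to an orthogonal vector.
  refine ⟨Matrix.of fun i j =>
    (onLastQubit hk (rotation (Real.pi / 2))).1 i j, ?_, fun x => ?_⟩
  · simp [onLastQubit, unitaryTensorOne, rotation]
  · have hJ : (rotation x).1
        = (Real.cos x : ℂ) • 1 + (Real.sin x : ℂ) • (rotation (Real.pi / 2)).1 := by
      ext i j
      fin_cases i <;> fin_cases j <;> simp [rotation]
    simp only [onLastQubit, unitaryTensorOne, hJ, Matrix.add_kronecker, Matrix.smul_kronecker,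
      Matrix.one_kronecker_one, Matrix.reindex_apply, Matrix.submatrix_add, Matrix.submatrix_smul,
      Pi.add_apply, Pi.smul_apply, Matrix.submatrix_one_equiv]
    rfl

/-- The difference of the conjugations by `A` and by its rotation towards `B` by `x` is `sin x`
times a difference of conjugations by two other rotations. -/
theorem conjMap_rotate {X : Type} [Fintype X] (A B : Matrix X X ℂ) (x : ℝ) :
    conjMap A + (Real.sin x : ℂ) • conjMap ((Real.cos (x / 2 + Real.pi / 4) : ℂ) • A
        + (Real.sin (x / 2 + Real.pi / 4) : ℂ) • B)
      = conjMap ((Real.cos x : ℂ) • A + (Real.sin x : ℂ) • B)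
        + (Real.sin x : ℂ) • conjMap ((Real.cos (x / 2 - Real.pi / 4) : ℂ) • A
          + (Real.sin (x / 2 - Real.pi / 4) : ℂ) • B) := by
  -- Conjugation by `cos y A + sin y B` is affine in the point of the unit circle at angle `2y`. The
  -- chord between the angles `0` and `2x` is `sin x` times the parallel diameter, whose ends lie at
  -- `x ± π / 2`; halving gives `x / 2 ± π / 4`.
  have hexp : ∀ (y : ℝ) (ρ : Matrix X X ℂ),
      conjMap ((Real.cos y : ℂ) • A + (Real.sin y : ℂ) • B) ρ
        = ((Real.cos y ^ 2 : ℝ) : ℂ) • (A * ρ * A.conjTranspose)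
          + ((Real.sin y * Real.cos y : ℝ) : ℂ) •
            (A * ρ * B.conjTranspose + B * ρ * A.conjTranspose)
          + ((Real.sin y ^ 2 : ℝ) : ℂ) • (B * ρ * B.conjTranspose) := fun y ρ => by
    simp only [conjMap, LinearMap.coe_mk, AddHom.coe_mk, Matrix.conjTranspose_add,
      Matrix.conjTranspose_smul, Complex.star_def, Complex.conj_ofReal, Matrix.add_mul,
      Matrix.mul_add, Matrix.smul_mul, Matrix.mul_smul]
    push_cast
    module
  have hcos : ∀ y : ℝ, Real.cos y ^ 2 = (1 + Real.cos (2 * y)) / 2 := fun y => by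
    rw [Real.cos_sq]; ring
  have hsin : ∀ y : ℝ, Real.sin y ^ 2 = (1 - Real.cos (2 * y)) / 2 := fun y => by
    rw [Real.sin_sq_eq_half_sub]; ring
  have hsc : ∀ y : ℝ, Real.sin y * Real.cos y = Real.sin (2 * y) / 2 := fun y => by
    rw [Real.sin_two_mul]; ring
  have e1 : 2 * (x / 2 + Real.pi / 4) = x + Real.pi / 2 := by ring
  have e2 : 2 * (x / 2 - Real.pi / 4) = x - Real.pi / 2 := by ring
  ext1 ρ
  simp only [LinearMap.add_apply, LinearMap.smul_apply]
  rw [hexp x, hexp, hexp, hcos (x / 2 + _), hcos (x / 2 - _), hsin (x / 2 + _),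
    hsin (x / 2 - _), hsc (x / 2 + _), hsc (x / 2 - _), e1, e2, Real.cos_add_pi_div_two,
    Real.sin_add_pi_div_two, Real.cos_sub_pi_div_two, Real.sin_sub_pi_div_two]
  change A * ρ * A.conjTranspose + _ = _
  push_cast
  rw [Complex.cos_sq']
  module

/-- The basis state `|0 … 0⟩⟨0 … 0|`. -/
def zeroState (k : ℕ) : Density (Qubits k) where
  mat := Matrix.single 0 0 1
  posSemidef := by
    have h := Matrix.posSemidef_self_mul_conjTranspose
      (Matrix.single (0 : Qubits k) (0 : Qubits k) (1 : ℂ))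
    simpa using h
  trace_eq_one := by simp

theorem zeroState_mul_mul (k : ℕ) (M : Matrix (Qubits k) (Qubits k) ℂ) :
    (zeroState k).mat * M * (zeroState k).mat = M 0 0 • (zeroState k).mat := by
  simp [zeroState, Matrix.single_mul_mul_single]

/-- The bound for a family of attacks that rotate the last qubit. -/
theorem le_of_rotation_attack {k : ℕ} (π : Protocol k) {N : ℝ}
    (hN : HasSum (fun n : ℕ => (π.numTests n).toReal * (n : ℝ)) N) (hN' : 2 / 3 ≤ N)
    {εH εD : ℝ} (hH : IsCorrect π εH)
    (f : ℝ → Matrix.unitaryGroup (Qubits k) ℂ → Matrix.unitaryGroup (Qubits k) ℂ)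
    (K : Matrix.unitaryGroup (Qubits k) ℂ → Matrix (Qubits k) (Qubits k) ℂ)
    (hf : ∀ x V, (f x V).1 = (Real.cos x : ℂ) • V.1 + (Real.sin x : ℂ) • K V)
    (hK : K 1 0 0 = 0) (hD : ∀ x, IsSecure π {replaceUnitary (f x)} εD) :
    1 / (7 * N ^ 2) ≤ εH + εD := by
  have hNpos : 0 < N := by linarith
  -- The choice `N * s = 2 / 3` maximises `(1 - N * s) * s ^ 2`; `N ≥ 2 / 3` ensures `s ≤ 1`, so
  -- that `s` is a sine.
  set s : ℝ := 2 / (3 * N) with hs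
  have hs0 : 0 ≤ s := by positivity
  have hs1 : s ≤ 1 := by
    rw [hs, div_le_one (by positivity)]; linarith
  have hNs : N * s = 2 / 3 := by rw [hs]; field_simp
  set x := Real.arcsin s
  have hsin : Real.sin x = s := Real.sin_arcsin (by linarith) hs1
  have hcos0 : 0 ≤ Real.cos x := Real.cos_arcsin_nonneg s
  have hcos : Real.cos x ^ 2 = 1 - s ^ 2 := by rw [Real.cos_sq', hsin]
  set ψ := zeroState k
  have hψψ : ψ.mat * ψ.mat = ψ.mat := by
    have h := zeroState_mul_mul k 1
    rwa [Matrix.mul_one, Matrix.one_apply_eq, one_smul] at h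
  have hone : conjMap (1 : Matrix.unitaryGroup (Qubits k) ℂ).1 ψ.mat = ψ.mat := by
    simp [conjMap]
  have hhon : 1 - εH ≤ π.accept id := by
    have h := hH ψ 1
    rw [honest, π.output_replaceUnitary, idealOutput_eq_mixBot, id, hone] at h
    have h' := fidelity_mixBot (c := 1) ψ.posSemidef.isHermitian hψψ ψ.trace_eq_one zero_le_one
      (by rw [hψψ, hψψ]; simp) (π.accept_nonneg id) (π.accept_le_one id) zero_le_one le_rfl
    rw [h', sub_self, Real.sqrt_zero, Real.sqrt_one, mul_zero, add_zero, mul_one, mul_one,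
      Real.sq_sqrt (π.accept_nonneg id)] at h
    exact h
  have hatt : 1 - εD ≤ 1 - π.accept (f x) * s ^ 2 := by
    obtain ⟨p, ⟨hp0, hp1⟩, h⟩ := hD x ψ 1 _ rfl
    rw [π.output_replaceUnitary, idealOutput_eq_mixBot, hone] at h
    set P := (f x 1).1 with hP
    have hPP : P.conjTranspose * P = 1 := Matrix.mem_unitaryGroup_iff'.1 (f x 1).2
    have hP00 : P 0 0 = (Real.cos x : ℂ) := by
      rw [hP, hf]
      simp [hK]
    have hφ : conjMap P ψ.mat = P * ψ.mat * P.conjTranspose := rfl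
    -- The rotated state is again a rank-one projection. `M = 1` gives its idempotence, and `M =
    -- ψ.mat` its overlap `cos x ^ 2` with the correct state.
    have hmul : ∀ M : Matrix (Qubits k) (Qubits k) ℂ,
        conjMap P ψ.mat * M * conjMap P ψ.mat
          = (P.conjTranspose * M * P) 0 0 • conjMap P ψ.mat := fun M => by
      have e : conjMap P ψ.mat * M * conjMap P ψ.mat
          = P * (ψ.mat * (P.conjTranspose * M * P) * ψ.mat) * P.conjTranspose := by
        rw [hφ]; simp only [Matrix.mul_assoc]
      rw [e, zeroState_mul_mul, Matrix.mul_smul, Matrix.smul_mul, hφ]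
    have h00 : (P.conjTranspose * ψ.mat * P) 0 0 = ((Real.cos x ^ 2 : ℝ) : ℂ) := by
      have e : (P.conjTranspose * ψ.mat * P) 0 0 = star (P 0 0) * P 0 0 := by
        simp [ψ, zeroState, Matrix.mul_apply, Matrix.single_apply, ite_and]
      rw [e, hP00, Complex.star_def, Complex.conj_ofReal]
      push_cast
      ring
    have h1 := fidelity_mixBot_le (φ := conjMap P ψ.mat) (ψ := ψ.mat) (c := Real.cos x)
      (Matrix.isHermitian_mul_mul_conjTranspose P ψ.posSemidef.isHermitian)
      (by
        have h := hmul 1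
        rwa [Matrix.mul_one, Matrix.mul_one, hPP, Matrix.one_apply_eq, one_smul] at h)
      (((unitaryChannel (f x 1)).tracePreserving ψ.mat).trans ψ.trace_eq_one) hcos0
      (by rw [hmul, h00]) (π.accept_nonneg (f x)) (π.accept_le_one (f x)) hp0 hp1
    rw [hcos, sub_sub_cancel] at h1
    exact h.trans h1
  have hhyb : π.accept id ≤ π.accept (f x) + N * s := by
    refine π.accept_le_add id (f x) (f (x / 2 - Real.pi / 4)) (f (x / 2 + Real.pi / 4)) hs0
      (fun V => ?_) hN
    rw [hf, hf, hf, ← hsin]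
    exact conjMap_rotate V.1 (K V) x
  have hle1 := π.accept_le_one id
  have hs2 : s ^ 2 ≤ 1 := pow_le_one₀ hs0 hs1
  -- With `a₀ = π.accept id`, the bounds add up to `(1 - a₀) + (a₀ - 2 / 3) s ^ 2 = s ^ 2 / 3 + (1 -
  -- a₀) (1 - s ^ 2)`, and the last term is nonnegative.
  have hfinal : s ^ 2 / 3 ≤ εH + εD := by
    rw [hNs] at hhyb
    have h1 := mul_le_mul_of_nonneg_right hhyb (sq_nonneg s)
    have h2 := mul_nonneg (sub_nonneg.2 hle1) (sub_nonneg.2 hs2)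
    linarith
  refine le_trans ?_ hfinal
  have e : s ^ 2 / 3 = 4 / (27 * N ^ 2) := by rw [hs]; field_simp; norm_num
  -- What remains is `27 ≤ 28`, that is `1 / 7 ≤ 4 / 27`.
  rw [e, div_le_div_iff₀ (by positivity) (by positivity)]
  linarith [sq_nonneg N]

end VDQC

end

theorem mainTheorem3 (k : ℕ) (hk : 0 < k) (π : VDQC.Protocol k)
    (𝒜 : Set (VDQC.Attack (VDQC.Qubits k)))
    (h𝒜 : (∀ V : Matrix.unitaryGroup (Fin 2) ℂ, VDQC.lastQubitBefore hk V ∈ 𝒜) ∨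
      (∀ V : Matrix.unitaryGroup (Fin 2) ℂ, VDQC.lastQubitAfter hk V ∈ 𝒜))
    (N : ℝ) (hN : HasSum (fun n : ℕ => (π.numTests n).toReal * (n : ℝ)) N) (hN' : 2 / 3 ≤ N)
    (εH εD : ℝ) (hH : VDQC.IsCorrect π εH) (hD : VDQC.IsSecure π 𝒜 εD) :
    1 / (7 * N ^ 2) ≤ εH + εD := by
  obtain ⟨J, hJ, hrot⟩ := VDQC.exists_onLastQubit_rotation hk
  rcases h𝒜 with h | h
  -- As the rotation is `cos x • 1 + sin x • J`, the direction `K V` is `V J` here and `J V` in the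
  -- other case; both are `J` at `V = 1`.
  · refine VDQC.le_of_rotation_attack π hN hN' hH
      (fun x V => V * VDQC.onLastQubit hk (VDQC.rotation x)) (fun V => V.1 * J) (fun x V => ?_)
      (by simpa using hJ) (fun x ψ U att hatt => ?_)
    · change V.1 * (VDQC.onLastQubit hk (VDQC.rotation x)).1 = _
      rw [hrot, Matrix.mul_add, Matrix.mul_smul, Matrix.mul_smul, Matrix.mul_one]
    · rw [Set.mem_singleton_iff.1 hatt]
      exact hD ψ U _ (h (VDQC.rotation x))
  · refine VDQC.le_of_rotation_attack π hN hN' hH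
      (fun x V => VDQC.onLastQubit hk (VDQC.rotation x) * V) (fun V => J * V.1) (fun x V => ?_)
      (by simpa using hJ) (fun x ψ U att hatt => ?_)
    · change (VDQC.onLastQubit hk (VDQC.rotation x)).1 * V.1 = _
      rw [hrot, Matrix.add_mul, Matrix.smul_mul, Matrix.smul_mul, Matrix.one_mul]
    · rw [Set.mem_singleton_iff.1 hatt]
      exact hD ψ U _ (h (VDQC.rotation x))
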